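/- Let $K$ be a field, let $\mathcal G$ be an abelian group and let $\mathcal H\cong\mathbb Z^n$ be a free abelian group with basis $e_1,\dots,e_n$. Let $\le$ be a translation-invariant total order on $\mathcal G\oplus\mathcal H$, and let $K_w[\mathcal G\oplus\mathcal H]$ be the field of Malcev–Neumann series, that is, of formal series $\eta=\sum_{\gamma\in\mathcal G\oplus\mathcal H}c_\gamma t^\gamma$ with $c_\gamma\in K$ and well-ordered support; for $\eta\neq0$ let $\mathrm{ord}(\eta)$ be the least element of its support. Put $x_i=t^{e_i}$, and let $K_w[\mathcal G]$ be the field of series supported in $\mathcal G\oplus 0$. Every series can be written uniquely as $\eta=\sum_{\mathbf k\in\mathbb Z^n}b_{\mathbf k}\mathbf x^{\mathbf k}$ with $b_{\mathbf k}\in K_w[\mathcal G]$. The nonzero $b_{\mathbf k}\mathbf x^{\mathbf k}$ are the $x$-terms of $\eta$; if $\eta\ne0$, the $x$-term of least order is the $x$-initial term of $\eta$. Put $\mathrm{CT}_{\mathbf x}\,\eta=b_{\mathbf 0}$ and $\frac{\partial\eta}{\partial x_i}=\sum_{\mathbf k}k_i\,b_{\mathbf k}\,\mathbf x^{\mathbf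 k}x_i^{-1}$. Let $F_1,\dots,F_n\in K_w[\mathcal G\oplus\mathcal H]$ be nonzero, and let $a_ix_1^{b_{i1}}\cdots x_n^{b_{in}}$ with $a_i\in K_w[\mathcal G]$ be the $x$-initial term of $F_i$. The Jacobian number is the integer $j(F_1,\dots,F_n)=\det(b_{ij})_{1\le i,j\le n}$, and the log Jacobian is $$LJ(F_1,\dots,F_n)=\frac{x_1\cdots x_n}{F_1\cdots F_n}\,\det\left(\frac{\partial F_i}{\partial x_j}\right)_{1\le i,j\le n}.$$ Proposition. If $j(F_1,\dots,F_n)$ is nonzero as an element of $K$, then $LJ(F_1,\dots,F_n)$ is nonzero and its $x$-initial term equals $j(F_1,\dots,F_n)$. In particular $\mathrm{CT}_{\mathbf x}\,LJ(F_1,\dots,F_n)=j(F_1,\dots,F_n)$. -/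

import Mathlib

namespace MalcevNeumann

/-! For a totally ordered abelian group `Γ` and a field `K`, the field of Malcev-Neumann series on
`Γ` over `K` is `HahnSeries Γ K` (in a linear order, partially well-ordered sets are exactly the
well-ordered sets). The decomposition of `Γ` as a direct sum of `G` and a free abelian group with
basis `e_1, …, e_n` is an additive isomorphism `φ : Γ ≃+ G × (Fin n → ℤ)`; the order on `Γ` is
arbitrary (it need not be lexicographic). The field of series on `G` is identified with the series
on `Γ` whose support lies in `G ⊕ 0`. -/

variable {Γ G K : Type*} {n : ℕ}

section Exponents

variable [AddCommGroup Γ] [AddCommGroup G]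

/-- The exponent vector in `x_1, …, x_n` of the monomial `t ^ γ`. -/
def xExp (φ : Γ ≃+ G × (Fin n → ℤ)) (γ : Γ) : Fin n → ℤ :=
  (φ γ).2

/-- The basis element `e_i` of the free part. -/
def basisElt (φ : Γ ≃+ G × (Fin n → ℤ)) (i : Fin n) : Γ :=
  φ.symm (0, Pi.single i 1)

end Exponents

noncomputable section

variable [AddCommGroup Γ] [LinearOrder Γ] [AddCommGroup G] [Field K]

/-- The variable `x_i = t ^ e_i`. -/
def xVar (K : Type*) [Field K] (φ : Γ ≃+ G × (Fin n → ℤ)) (i : Fin n) : HahnSeries Γ K :=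
  HahnSeries.single (basisElt φ i) 1

open Classical in
/-- The part `b_k x ^ k` of the series `η = ∑ k, b_k x ^ k`. It is called an `x`-term of `η` when
it is nonzero. -/
def xTerm (φ : Γ ≃+ G × (Fin n → ℤ)) (k : Fin n → ℤ) (η : HahnSeries Γ K) : HahnSeries Γ K where
  coeff γ := if xExp φ γ = k then η.coeff γ else 0
  isPWO_support' := η.isPWO_support.mono fun γ hγ => by
    simp only [Function.mem_support, ne_eq, ite_eq_right_iff, Classical.not_imp] at hγ
    exact hγ.2

/-- `b_k x ^ k` is the `x`-initial term of `η`: it is an `x`-term, and has the least order among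
all `x`-terms. -/
def IsXInitialExponent (φ : Γ ≃+ G × (Fin n → ℤ)) (η : HahnSeries Γ K) (k : Fin n → ℤ) : Prop :=
  xTerm φ k η ≠ 0 ∧
    ∀ k' : Fin n → ℤ, xTerm φ k' η ≠ 0 → (xTerm φ k η).order ≤ (xTerm φ k' η).order

theorem exists_isXInitialExponent (φ : Γ ≃+ G × (Fin n → ℤ)) (η : HahnSeries Γ K) (hη : η ≠ 0) :
    ∃ k, IsXInitialExponent φ η k := by
  have h0 : η.coeff η.order ≠ 0 := by
    simpa using (HahnSeries.coeff_order_eq_zero (x := η)).not.mpr hη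
  have h1 : (xTerm φ (xExp φ η.order) η).coeff η.order ≠ 0 := by
    simpa [xTerm] using h0
  refine ⟨xExp φ η.order, fun h => h1 (by rw [h]; rfl), fun k' hk' => ?_⟩
  refine (HahnSeries.order_le_of_coeff_ne_zero h1).trans
    (HahnSeries.order_le_of_coeff_ne_zero fun h => hk' ?_)
  refine HahnSeries.coeff_order_eq_zero.mp ?_
  change (if _ then _ else _) = _
  rw [h, ite_self]

/-- The exponent of the `x`-initial term of a nonzero series (and `0` for the zero series). -/
def xInitialExponent (φ : Γ ≃+ G × (Fin n → ℤ)) (η : HahnSeries Γ K) : Fin n → ℤ :=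
  open Classical in
  if h : η ≠ 0 then (exists_isXInitialExponent φ η h).choose else 0

/-- The `x`-initial term of a nonzero series (and `0` for the zero series). -/
def xInitialTerm (φ : Γ ≃+ G × (Fin n → ℤ)) (η : HahnSeries Γ K) : HahnSeries Γ K :=
  xTerm φ (xInitialExponent φ η) η

/-- The constant term in `x` of `η = ∑ k, b_k x ^ k`, namely `b_0`, a series on `G`. -/
def constTerm (φ : Γ ≃+ G × (Fin n → ℤ)) (η : HahnSeries Γ K) : HahnSeries Γ K :=
  xTerm φ 0 η

variable [IsOrderedAddMonoid Γ]

/-- The partial derivative with respect to `x_i`, which multiplies the part of `η` of exponent `m`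
in `x_i` by `m` and lowers that exponent by one. -/
def xDeriv (φ : Γ ≃+ G × (Fin n → ℤ)) (i : Fin n) (η : HahnSeries Γ K) : HahnSeries Γ K where
  coeff γ := ((xExp φ (γ + basisElt φ i) i : ℤ) : K) * η.coeff (γ + basisElt φ i)
  isPWO_support' := by
    have hmono : Monotone fun γ : Γ => γ - basisElt φ i := fun _ _ h => sub_le_sub_right h _
    refine (η.isPWO_support.image_of_monotone hmono).mono fun γ hγ => ?_
    exact ⟨γ + basisElt φ i, right_ne_zero_of_mul hγ, add_sub_cancel_right _ _⟩

/-- The Jacobian determinant `det (∂ F_i / ∂ x_j)`. -/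
def jacobian (φ : Γ ≃+ G × (Fin n → ℤ)) (F : Fin n → HahnSeries Γ K) : HahnSeries Γ K :=
  (Matrix.of fun i j => xDeriv φ j (F i)).det

/-- The Jacobian number `det (b_ij)`, where `(b_i1, …, b_in)` is the exponent of the `x`-initial
term of `F_i`. -/
def jacobianNumber (φ : Γ ≃+ G × (Fin n → ℤ)) (F : Fin n → HahnSeries Γ K) : ℤ :=
  (Matrix.of fun i j => xInitialExponent φ (F i) j).det

/-- The log Jacobian `(x_1 ⋯ x_n) / (F_1 ⋯ F_n) * J(F_1, …, F_n)`. -/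
def logJacobian (φ : Γ ≃+ G × (Fin n → ℤ)) (F : Fin n → HahnSeries Γ K) : HahnSeries Γ K :=
  (∏ i, xVar K φ i) / (∏ i, F i) * jacobian φ F

end

end MalcevNeumann

namespace MalcevNeumann

/-! ### Derivations, determinants and cofactors. -/

section Piola

open Matrix

/-! With `θ_j = x_j ∂/∂x_j`, the log Jacobian is `det (F_i⁻¹ θ_j F_i)`. Write `F_i` as its leading
monomial times `1 - v_i`, with `v_i` of positive order. In characteristic zero the entries are `b_ij
+ θ_j log (1 - v_i)`, a constant plus an exact term. By the Piola identity the exact terms change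
the determinant only by a sum of `θ_j`-derivatives (`map_det_add_exact`), which have no terms of
exponent zero in `x`; so the constant term is `det b`. In general the coefficients are lifted to a
polynomial ring over `ℤ` (`coeff_logDet`). No entry has terms of negative degree, hence neither has
the determinant. If `det b ≠ 0` in `K`, its order is therefore `0`, and the `x`-initial term is the
constant term. -/

theorem derivation_prod {R : Type*} [CommRing R] {ι : Type*} [DecidableEq ι]
    (D : Derivation ℤ R R) (s : Finset ι) (f : ι → R) :
    D (∏ i ∈ s, f i) = ∑ i ∈ s, ∏ j ∈ s, if j = i then D (f j) else f j := by
  induction s using Finset.induction_on with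
  | empty => simp
  | insert a s ha ih =>
    rw [Finset.prod_insert ha, D.leibniz, ih, Finset.sum_insert ha, Finset.prod_insert ha,
      if_pos rfl, add_comm, smul_eq_mul, smul_eq_mul, Finset.mul_sum, mul_comm]
    congr 1
    · refine congrArg _ (Finset.prod_congr rfl fun j hj => ?_)
      rw [if_neg (ne_of_mem_of_not_mem hj ha)]
    · refine Finset.sum_congr rfl fun i hi => ?_
      rw [Finset.prod_insert ha, if_neg (ne_of_mem_of_not_mem hi ha).symm]

variable {R : Type*} [CommRing R] {ι : Type*} [Fintype ι] [DecidableEq ι]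

theorem derivation_det (D : Derivation ℤ R R) (M : Matrix ι ι R) :
    D M.det = ∑ i, (M.updateRow i fun k => D (M i k)).det := by
  -- After transposing, the products in the Leibniz formula run over rows, as `updateRow` requires.
  rw [← det_transpose, det_apply, map_sum]
  simp_rw [← det_transpose (M.updateRow _ _), det_apply]
  rw [Finset.sum_comm]
  refine Finset.sum_congr rfl fun σ _ => ?_
  rw [← Finset.smul_sum, Units.smul_def, map_zsmul, derivation_prod, ← Units.smul_def]
  refine congrArg _ (Finset.sum_congr rfl fun i _ => ?_)
  refine Finset.prod_congr rfl fun j _ => ?_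
  rcases eq_or_ne j i with rfl | hj
  · simp
  · simp [hj]

theorem det_updateRow_eq_sum (M : Matrix ι ι R) (i : ι) (v : ι → R) :
    (M.updateRow i v).det = ∑ k, v k * (M.updateRow i (Pi.single k 1)).det := by
  refine (LinearMap.pi_apply_eq_sum_univ
    ((detRowAlternating (R := R) (n := ι)).toMultilinearMap.toLinearMap M i) v).trans ?_
  refine Finset.sum_congr rfl fun k _ => congrArg (fun w => v k * (M.updateRow i w).det) ?_
  ext j
  simp [Pi.single_apply, eq_comm]

/-- The Piola identity: the cofactors of a row are divergence free if the other rows are closed. -/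
theorem sum_derivation_cofactor (D : ι → Derivation ℤ R R) (A : Matrix ι ι R) (r : ι)
    (hA : ∀ i j k, D j (A i k) = D k (A i j)) :
    ∑ j, D j (A.updateRow r (Pi.single j 1)).det = 0 := by
  simp_rw [derivation_det]
  rw [Finset.sum_comm]
  refine Finset.sum_eq_zero fun i _ => ?_
  rcases eq_or_ne i r with rfl | hi
  · refine Finset.sum_eq_zero fun j _ => det_eq_zero_of_row_eq_zero i fun k => ?_
    rcases eq_or_ne k j with rfl | hk
    · rw [updateRow_self, updateRow_self, Pi.single_eq_same, Derivation.map_one_eq_zero]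
    · rw [updateRow_self, updateRow_self, Pi.single_eq_of_ne hk, map_zero]
  · simp_rw [updateRow_ne hi]
    rw [Finset.sum_congr rfl fun j _ => det_updateRow_eq_sum _ i _, ← Finset.sum_product']
    have hswap : ∀ j k : ι, ((A.updateRow r (Pi.single j 1)).updateRow i (Pi.single k 1)).det
        = -((A.updateRow r (Pi.single k 1)).updateRow i (Pi.single j 1)).det := by
      intro j k
      have := (detRowAlternating (R := R) (n := ι)).map_swap
        ((A.updateRow r (Pi.single k 1)).updateRow i (Pi.single j 1)) hi
      refine Eq.trans (congrArg det ?_) this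
      ext a b
      change _ = (A.updateRow r (Pi.single k 1)).updateRow i (Pi.single j 1) (Equiv.swap i r a) b
      by_cases ha : a = i
      · rw [ha, Equiv.swap_apply_left, updateRow_self, updateRow_ne hi.symm, updateRow_self]
      · by_cases ha' : a = r
        · rw [ha', Equiv.swap_apply_right, updateRow_ne hi.symm, updateRow_self, updateRow_self]
        · rw [Equiv.swap_apply_of_ne_of_ne ha ha']
          simp [ha, ha']
    -- `D j (A i k)` is symmetric in `j, k` and the minors are antisymmetric, so the terms cancel in
    -- pairs; diagonal terms have two equal rows.
    refine Finset.sum_involution (fun a _ => a.swap) ?_ ?_ (by simp) (by simp)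
    · rintro ⟨j, k⟩ -
      simp only [Prod.swap]
      rw [hswap j k, hA i j k]
      ring
    · rintro ⟨j, k⟩ - h heq
      obtain rfl : k = j := congrArg Prod.fst heq
      refine h (mul_eq_zero_of_right _ (det_zero_of_row_eq hi ?_))
      rw [updateRow_self, updateRow_ne hi.symm, updateRow_self]

/-- Exact rows do not contribute to the image of a determinant of closed rows under a map that
kills all derivatives. -/
theorem map_det_add_exact {T : Type*} [AddCommGroup T] (Z : R →+ T) (D : ι → Derivation ℤ R R)
    (hZ : ∀ j f, Z (D j f) = 0) (hD : ∀ j k f, D j (D k f) = D k (D j f))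
    (b : Matrix ι ι R) (hb : ∀ i j k, D k (b i j) = 0) (f : ι → R) :
    Z (Matrix.of fun i j => b i j + D j (f i)).det = Z b.det := by
  -- The exact parts are added one row at a time; all rows stay closed because the derivations
  -- commute.
  have key : ∀ s : Finset ι,
      Z (Matrix.of fun i j => b i j + if i ∈ s then D j (f i) else 0).det = Z b.det := by
    intro s
    induction s using Finset.induction_on with
    | empty => simp; rfl
    | insert r s hr ih =>
      set M := Matrix.of fun i j => b i j + if i ∈ s then D j (f i) else 0 with hM
      have hclosed : ∀ i j k, D j (M i k) = D k (M i j) := by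
        intro i j k
        by_cases hi : i ∈ s
        · simp [hM, hi, hb, hD j k]
        · simp [hM, hi, hb]
      have h1 : (Matrix.of fun i j => b i j + if i ∈ insert r s then D j (f i) else 0)
          = M.updateRow r (M r + fun j => D j (f r)) := by
        ext i j
        rcases eq_or_ne i r with rfl | hi
        · simp [hM, hr]
        · simp [hM, hi]
      have h2 : (M.updateRow r fun j => D j (f r)).det
          = ∑ j, D j (f r * (M.updateRow r (Pi.single j 1)).det) := by
        rw [det_updateRow_eq_sum]
        simp_rw [Derivation.leibniz, smul_eq_mul]
        rw [Finset.sum_add_distrib, ← Finset.mul_sum, sum_derivation_cofactor D M r hclosed,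
          mul_zero, zero_add]
        exact Finset.sum_congr rfl fun j _ => mul_comm _ _
      rw [h1, det_updateRow_add, updateRow_eq_self, map_add, ih, h2, map_sum,
        Finset.sum_eq_zero fun j _ => hZ j _, add_zero]
  simpa using key Finset.univ

end Piola

end MalcevNeumann

namespace MalcevNeumann

/-! ### Euler derivations and logarithms of Hahn series. -/

section Euler

open HahnSeries

variable {Γ : Type*} [AddCommGroup Γ] [LinearOrder Γ] [IsOrderedAddMonoid Γ]

/-- The series obtained from `f` by multiplying the coefficient at `γ` by `χ γ`. -/
def eulerFun {R : Type*} [CommRing R] (χ : Γ →+ ℤ) (f : HahnSeries Γ R) : HahnSeries Γ R where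
  coeff γ := (χ γ : R) * f.coeff γ
  isPWO_support' := f.isPWO_support.mono fun _ h => right_ne_zero_of_mul h

omit [IsOrderedAddMonoid Γ] in
theorem support_eulerFun_subset {R : Type*} [CommRing R] (χ : Γ →+ ℤ) (f : HahnSeries Γ R) :
    (eulerFun χ f).support ⊆ f.support :=
  fun _ h => right_ne_zero_of_mul (mem_support _ _ |>.1 h)

theorem eulerFun_mul {R : Type*} [CommRing R] (χ : Γ →+ ℤ) (f g : HahnSeries Γ R) :
    eulerFun χ (f * g) = f * eulerFun χ g + g * eulerFun χ f := by
  ext γ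
  -- All three products are summed over the same antidiagonal, so that they can be compared
  -- termwise.
  rw [HahnSeries.coeff_add, coeff_mul_right' g.isPWO_support (support_eulerFun_subset χ g),
    mul_comm g, coeff_mul_left' f.isPWO_support (support_eulerFun_subset χ f),
    ← Finset.sum_add_distrib]
  change (χ γ : R) * (f * g).coeff γ = _
  rw [coeff_mul, Finset.mul_sum]
  refine Finset.sum_congr rfl fun p hp => ?_
  rw [← (Finset.mem_antidiagonal.1 hp).2.2, map_add, Int.cast_add]
  change _ = f.coeff p.1 * ((χ p.2 : R) * g.coeff p.2)
    + (χ p.1 : R) * f.coeff p.1 * g.coeff p.2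
  ring

/-- The derivation of a ring of Hahn series multiplying the coefficient at `γ` by `χ γ`. -/
noncomputable def eulerDeriv (R : Type*) [CommRing R] (χ : Γ →+ ℤ) :
    Derivation ℤ (HahnSeries Γ R) (HahnSeries Γ R) :=
  Derivation.mk'
    (AddMonoidHom.toIntLinearMap
      { toFun := eulerFun χ
        map_zero' := by ext; simp [eulerFun]
        map_add' := fun f g => by ext; simp [eulerFun, mul_add] })
    (eulerFun_mul χ)

variable {R S : Type*} [CommRing R] [CommRing S]

@[simp]
theorem coeff_eulerDeriv (χ : Γ →+ ℤ) (f : HahnSeries Γ R) (γ : Γ) :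
    (eulerDeriv R χ f).coeff γ = (χ γ : R) * f.coeff γ := rfl

theorem eulerDeriv_comm (χ ψ : Γ →+ ℤ) (f : HahnSeries Γ R) :
    eulerDeriv R χ (eulerDeriv R ψ f) = eulerDeriv R ψ (eulerDeriv R χ f) := by
  ext γ
  simp only [coeff_eulerDeriv]
  ring

theorem eulerDeriv_single (χ : Γ →+ ℤ) (γ : Γ) (r : R) :
    eulerDeriv R χ (single γ r) = C (χ γ : R) * single γ r := by
  ext δ
  rw [coeff_eulerDeriv, C_apply, coeff_single_zero_mul]
  rcases eq_or_ne δ γ with rfl | h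
  · rfl
  · simp [coeff_single_of_ne h]

theorem eulerDeriv_C (χ : Γ →+ ℤ) (r : R) : eulerDeriv R χ (C r) = 0 := by
  rw [C_apply, eulerDeriv_single]
  simp

/-- The map of rings of Hahn series induced by a ring homomorphism on coefficients. -/
noncomputable def mapCoeffHom (Γ : Type*) [AddCommGroup Γ] [LinearOrder Γ] [IsOrderedAddMonoid Γ]
    (σ : R →+* S) : HahnSeries Γ R →+* HahnSeries Γ S where
  toFun f := f.map σ
  map_one' := HahnSeries.map_one σ.toMonoidWithZeroHom
  map_mul' _ _ := HahnSeries.map_mul σ.toNonUnitalRingHom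
  map_zero' := HahnSeries.map_zero (σ : R →+ S).toZeroHom
  map_add' _ _ := HahnSeries.map_add σ.toAddMonoidHom

@[simp]
theorem coeff_mapCoeffHom (σ : R →+* S) (f : HahnSeries Γ R) (γ : Γ) :
    (mapCoeffHom Γ σ f).coeff γ = σ (f.coeff γ) := rfl

theorem mapCoeffHom_C (σ : R →+* S) (r : R) : mapCoeffHom Γ σ (C r) = C (σ r) :=
  HahnSeries.map_C r σ

theorem mapCoeffHom_eulerDeriv (σ : R →+* S) (χ : Γ →+ ℤ) (f : HahnSeries Γ R) :
    mapCoeffHom Γ σ (eulerDeriv R χ f) = eulerDeriv S χ (mapCoeffHom Γ σ f) := by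
  ext γ
  simp

theorem orderTop_pos_iff (f : HahnSeries Γ R) :
    0 < f.orderTop ↔ ∀ γ ≤ 0, f.coeff γ = 0 := by
  constructor
  · intro h γ hγ
    exact coeff_eq_zero_of_lt_orderTop ((WithTop.coe_le_coe.2 hγ).trans_lt h)
  · intro h
    rcases eq_or_ne f 0 with rfl | hf
    · simp
    · rw [zero_lt_orderTop_iff hf]
      by_contra hlt
      exact hf (coeff_order_eq_zero.1 (h _ (not_lt.1 hlt)))

/-- In characteristic zero, `log (1 - v)` exists for every series `v` of positive order. -/
theorem exists_log [Algebra ℚ R] (v : HahnSeries Γ R) (hv : 0 < v.orderTop) :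
    ∃ L : HahnSeries Γ R, ∀ χ : Γ →+ ℤ, eulerDeriv R χ L * (1 - v) = eulerDeriv R χ (1 - v) := by
  -- The family `v ^ (k + 1) / (k + 1)`, with sum `-log (1 - v)`; its termwise derivative is `θ v`
  -- times the geometric series.
  let T : SummableFamily Γ R ℕ :=
    SummableFamily.smulFamily (fun k => algebraMap ℚ R (1 / ((k : ℚ) + 1)))
      (v • SummableFamily.powers v)
  have hT : ∀ k, T k = algebraMap ℚ R (1 / ((k : ℚ) + 1)) • v ^ (k + 1) := by
    intro k
    simp [T, SummableFamily.smulFamily, hv, pow_succ', of_symm_smul_of_eq_mul]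
  refine ⟨-T.hsum, fun χ => ?_⟩
  have hDT : ∀ k, eulerDeriv R χ (T k) = eulerDeriv R χ v * v ^ k := by
    intro k
    rw [hT, ← C_mul_eq_smul, Derivation.leibniz, eulerDeriv_C, smul_zero, add_zero,
      Derivation.leibniz_pow, Nat.add_sub_cancel, smul_eq_mul, smul_eq_mul, nsmul_eq_mul,
      ← mul_assoc]
    have : (C (algebraMap ℚ R (1 / ((k : ℚ) + 1))) : HahnSeries Γ R) * ((k + 1 : ℕ) : HahnSeries Γ R)
        = 1 := by
      rw [← map_natCast (C : R →+* HahnSeries Γ R), ← map_mul, ← map_natCast (algebraMap ℚ R),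
        ← map_mul, Nat.cast_add, Nat.cast_one, one_div_mul_cancel (by positivity), map_one, map_one]
    rw [this, one_mul, mul_comm]
  have hD : eulerDeriv R χ T.hsum = eulerDeriv R χ v * (SummableFamily.powers v).hsum := by
    rw [← SummableFamily.hsum_smul]
    ext γ
    rw [coeff_eulerDeriv, SummableFamily.coeff_hsum, SummableFamily.coeff_hsum,
      mul_finsum' _ _ (T.finite_co_support γ)]
    refine finsum_congr fun k => ?_
    rw [← coeff_eulerDeriv, hDT]
    simp [hv, of_symm_smul_of_eq_mul]
  rw [map_neg, hD, map_sub, Derivation.map_one_eq_zero, zero_sub, neg_mul, mul_assoc,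
    mul_comm _ (1 - v), SummableFamily.one_sub_self_mul_hsum_powers hv, mul_one]

end Euler

end MalcevNeumann

namespace MalcevNeumann

/-! ### The determinant of logarithmic derivatives. -/

section LogJacobian

open HahnSeries

variable {Γ : Type*} [AddCommGroup Γ] [LinearOrder Γ] [IsOrderedAddMonoid Γ]
  {ι : Type*} [Fintype ι] [DecidableEq ι]

/-- The determinant of logarithmic derivatives of monomials with exponents `b i` times `1 - v i`,
where `q i` is the inverse of `1 - v i`. -/
noncomputable def logDet {R : Type*} [CommRing R] (χ : ι → Γ →+ ℤ) (b : Matrix ι ι ℤ)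
    (v q : ι → HahnSeries Γ R) : HahnSeries Γ R :=
  (Matrix.of fun i j => C (b i j : R) + eulerDeriv R (χ j) (1 - v i) * q i).det

variable {R S : Type*} [CommRing R] [CommRing S]

theorem det_C_intCast (b : Matrix ι ι ℤ) :
    (Matrix.of fun i j => (C (b i j : R) : HahnSeries Γ R)).det = C ((b.det : ℤ) : R) := by
  have h := (((C : R →+* HahnSeries Γ R).comp (Int.castRingHom R)).map_det b).symm
  exact h

theorem mapCoeffHom_logDet (σ : R →+* S) (χ : ι → Γ →+ ℤ) (b : Matrix ι ι ℤ)
    (v q : ι → HahnSeries Γ R) :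
    mapCoeffHom Γ σ (logDet χ b v q)
      = logDet χ b (fun i => mapCoeffHom Γ σ (v i)) (fun i => mapCoeffHom Γ σ (q i)) := by
  rw [logDet, RingHom.map_det, logDet]
  congr 1
  ext1 i j
  simp [mapCoeffHom_eulerDeriv]

/-- A `ZeroHom` is all that is available for lifting: the section in `coeff_logDet` is not additive.
-/
theorem orderTop_map_pos {f : HahnSeries Γ R} (hf : 0 < f.orderTop) (σ : ZeroHom R S) :
    0 < (f.map σ).orderTop := by
  rw [orderTop_pos_iff] at hf ⊢
  intro γ hγ
  rw [HahnSeries.map_coeff, hf γ hγ]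
  exact σ.map_zero

theorem orderTop_mapCoeffHom_pos {f : HahnSeries Γ R} (hf : 0 < f.orderTop) (σ : R →+* S) :
    0 < (mapCoeffHom Γ σ f).orderTop := by
  rw [orderTop_pos_iff] at hf ⊢
  intro γ hγ
  rw [coeff_mapCoeffHom, hf γ hγ, map_zero]

theorem coeff_logDet_of_algebra_rat [Algebra ℚ R] (χ : ι → Γ →+ ℤ) (b : Matrix ι ι ℤ)
    (v q : ι → HahnSeries Γ R) (hv : ∀ i, 0 < (v i).orderTop) (hq : ∀ i, (1 - v i) * q i = 1)
    {γ : Γ} (hγ : ∀ j, χ j γ = 0) :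
    (logDet χ b v q).coeff γ = (C ((b.det : ℤ) : R) : HahnSeries Γ R).coeff γ := by
  choose L hL using fun i => exists_log (v i) (hv i)
  have h : ∀ i j, eulerDeriv R (χ j) (1 - v i) * q i = eulerDeriv R (χ j) (L i) := by
    intro i j
    rw [← hL, mul_assoc, hq, mul_one]
  rw [logDet, ← det_C_intCast]
  simp_rw [h]
  exact map_det_add_exact (coeff.addMonoidHom γ) (fun j => eulerDeriv R (χ j))
    (fun j f => (coeff_eulerDeriv (χ j) f γ).trans (by rw [hγ, Int.cast_zero, zero_mul]))
    (fun j k f => eulerDeriv_comm _ _ f)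
    (Matrix.of fun i j => C (b i j : R)) (fun i j k => eulerDeriv_C _ _) L

/-- The coefficients without variables of the determinant of logarithmic derivatives, in any
characteristic: the identity is lifted to coefficients in a polynomial ring over `ℤ`. -/
theorem coeff_logDet (χ : ι → Γ →+ ℤ) (b : Matrix ι ι ℤ)
    (v q : ι → HahnSeries Γ R) (hv : ∀ i, 0 < (v i).orderTop) (hq : ∀ i, (1 - v i) * q i = 1)
    {γ : Γ} (hγ : ∀ j, χ j γ = 0) :
    (logDet χ b v q).coeff γ = (C ((b.det : ℤ) : R) : HahnSeries Γ R).coeff γ := by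
  classical
  obtain ⟨s, π, hπs⟩ : ∃ (s : ZeroHom R (MvPolynomial R ℤ)) (π : MvPolynomial R ℤ →+* R),
      ∀ r, π (s r) = r := by
    -- One variable for each coefficient; `0` must lift to `0` so that supports do not grow.
    refine ⟨⟨fun r => if r = 0 then 0 else MvPolynomial.X r, if_pos rfl⟩,
      (MvPolynomial.aeval (R := ℤ) (id : R → R)).toRingHom, fun r => ?_⟩
    by_cases hr : r = 0
    · simp [hr]
    · simp [hr]
  -- Logarithms exist over `ℚ`, and injectivity brings the identity back to `ℤ`.
  obtain ⟨e, he⟩ : ∃ e : MvPolynomial R ℤ →+* MvPolynomial R ℚ, Function.Injective e :=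
    ⟨MvPolynomial.map (Int.castRingHom ℚ), MvPolynomial.map_injective _ Int.cast_injective⟩
  let v' : ι → HahnSeries Γ (MvPolynomial R ℤ) := fun i => (v i).map s
  have hv' : ∀ i, 0 < (v' i).orderTop := fun i => orderTop_map_pos (hv i) s
  let q' : ι → HahnSeries Γ (MvPolynomial R ℤ) := fun i => (SummableFamily.powers (v' i)).hsum
  have hq' : ∀ i, (1 - v' i) * q' i = 1 :=
    fun i => SummableFamily.one_sub_self_mul_hsum_powers (hv' i)
  have hvπ : (fun i => mapCoeffHom Γ π (v' i)) = v := by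
    ext i δ
    exact hπs _
  -- Inverses of `1 - v i` are unique.
  have hqπ : (fun i => mapCoeffHom Γ π (q' i)) = q := by
    funext i
    have h := congrArg (mapCoeffHom Γ π) (hq' i)
    rw [map_mul, map_sub, map_one, show mapCoeffHom Γ π (v' i) = v i from congrFun hvπ i] at h
    calc _ = mapCoeffHom Γ π (q' i) * ((1 - v i) * q i) := by rw [hq, mul_one]
      _ = ((1 - v i) * mapCoeffHom Γ π (q' i)) * q i := by ring
      _ = q i := by rw [h, one_mul]
  have hlift : (logDet χ b v' q').coeff γ
      = (C ((b.det : ℤ) : MvPolynomial R ℤ) : HahnSeries Γ _).coeff γ := by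
    apply he
    rw [← coeff_mapCoeffHom, ← coeff_mapCoeffHom, mapCoeffHom_logDet, mapCoeffHom_C, map_intCast]
    refine coeff_logDet_of_algebra_rat χ b _ _
      (fun i => orderTop_mapCoeffHom_pos (hv' i) e) (fun i => ?_) hγ
    rw [← map_one (mapCoeffHom Γ e), ← map_sub, ← map_mul, hq']
  have h := congrArg π hlift
  rwa [← coeff_mapCoeffHom, ← coeff_mapCoeffHom, mapCoeffHom_logDet, mapCoeffHom_C, map_intCast,
    hvπ, hqπ] at h

/-! ### Orders and leading terms over a field. -/

/-- The subring of Hahn series without coefficients of negative degree. -/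
def nonnegSubring (Γ R : Type*) [AddCommGroup Γ] [LinearOrder Γ] [IsOrderedAddMonoid Γ]
    [CommRing R] : Subring (HahnSeries Γ R) where
  carrier := {f | ∀ γ < 0, f.coeff γ = 0}
  mul_mem' := by
    intro f g hf hg γ hγ
    rw [coeff_mul]
    refine Finset.sum_eq_zero fun p hp => ?_
    have hp' := (Finset.mem_antidiagonal.1 hp).2.2
    rcases lt_or_ge p.1 0 with h | h
    · rw [hf _ h, zero_mul]
    · rw [hg, mul_zero]
      by_contra h'
      exact absurd (add_nonneg h (not_lt.1 h')) (by rw [hp']; exact not_le.2 hγ)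
  one_mem' γ hγ := by rw [coeff_one, if_neg hγ.ne]
  add_mem' hf hg γ hγ := by rw [HahnSeries.coeff_add, hf γ hγ, hg γ hγ, add_zero]
  zero_mem' _ _ := rfl
  neg_mem' hf γ hγ := by rw [HahnSeries.coeff_neg, hf γ hγ, neg_zero]

theorem det_mem_subring (A : Subring R) (M : Matrix ι ι R) (hM : ∀ i j, M i j ∈ A) :
    M.det ∈ A := by
  rw [Matrix.det_apply]
  refine A.sum_mem fun σ _ => ?_
  rw [Units.smul_def]
  exact A.zsmul_mem (A.prod_mem fun i _ => hM _ _) _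

variable {K : Type*} [Field K]

/-- An Euler derivation does not enlarge the support, so it cannot lower the order. -/
theorem logDeriv_mem_nonnegSubring (χ : Γ →+ ℤ) {f : HahnSeries Γ K} (hf : f ≠ 0) :
    f⁻¹ * eulerDeriv K χ f ∈ nonnegSubring Γ K := by
  intro γ hγ
  by_contra hne
  set q := f⁻¹ * eulerDeriv K χ f with hq
  have hq0 : q ≠ 0 := fun h => hne (by rw [h]; rfl)
  have hfq : f * q = eulerDeriv K χ f := by rw [hq, mul_inv_cancel_left₀ hf]
  have h1 : f.order ≤ (f * q).order := by
    refine order_le_of_coeff_ne_zero (right_ne_zero_of_mul (a := (χ (f * q).order : K)) ?_)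
    rw [← coeff_eulerDeriv, ← hfq]
    exact coeff_order_eq_zero.not.2 (mul_ne_zero hf hq0)
  rw [order_mul hf hq0] at h1
  exact absurd ((le_add_iff_nonneg_right _).1 h1)
    (not_le.2 ((order_le_of_coeff_ne_zero hne).trans_lt hγ))

/-- A nonzero series is its leading monomial times `1 - v` with `v` of positive order. -/
theorem exists_eq_single_mul {f : HahnSeries Γ K} (hf : f ≠ 0) :
    ∃ v : HahnSeries Γ K, 0 < v.orderTop ∧ f = single f.order (f.coeff f.order) * (1 - v) := by
  have hc : f.coeff f.order ≠ 0 := coeff_order_eq_zero.not.2 hf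
  refine ⟨1 - single (-f.order) (f.coeff f.order)⁻¹ * f, ?_, ?_⟩
  · rw [orderTop_pos_iff]
    intro γ hγ
    rw [HahnSeries.coeff_sub, coeff_single_mul, sub_neg_eq_add, coeff_one]
    rcases hγ.eq_or_lt with rfl | h
    · rw [zero_add, inv_mul_cancel₀ hc, if_pos rfl, sub_self]
    · rw [if_neg h.ne, coeff_eq_zero_of_lt_order (add_lt_of_neg_left _ h), mul_zero, sub_zero]
  · rw [sub_sub_cancel, ← mul_assoc, single_mul_single, add_neg_cancel, mul_inv_cancel₀ hc]
    exact (one_mul f).symm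

theorem logDeriv_single_mul (χ : Γ →+ ℤ) {γ : Γ} {c : K} (hc : c ≠ 0) {h : HahnSeries Γ K}
    (hh : h ≠ 0) :
    (single γ c * h)⁻¹ * eulerDeriv K χ (single γ c * h)
      = C (χ γ : K) + eulerDeriv K χ h * h⁻¹ := by
  have hs : single γ c ≠ 0 := single_ne_zero hc
  rw [Derivation.leibniz, eulerDeriv_single, smul_eq_mul, smul_eq_mul]
  field_simp
  ring

variable {G : Type*} [AddCommGroup G] {n : ℕ} (φ : Γ ≃+ G × (Fin n → ℤ))

/-- The exponent of `x_j` as a character of the group of exponents. -/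
def xExpHom (j : Fin n) : Γ →+ ℤ where
  toFun γ := xExp φ γ j
  map_zero' := by simp [xExp]
  map_add' := by simp [xExp]

theorem xVar_mul_xDeriv (j : Fin n) (f : HahnSeries Γ K) :
    xVar K φ j * xDeriv φ j f = eulerDeriv K (xExpHom φ j) f := by
  ext γ
  rw [xVar, coeff_single_mul, one_mul]
  change ((xExp φ (γ - basisElt φ j + basisElt φ j) j : ℤ) : K)
    * f.coeff (γ - basisElt φ j + basisElt φ j) = _
  rw [sub_add_cancel]
  rfl

/-- Row `i` absorbs `(F i)⁻¹` and column `j` absorbs `x_j`. -/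
theorem logJacobian_eq_det (F : Fin n → HahnSeries Γ K) :
    logJacobian φ F
      = (Matrix.of fun i j => (F i)⁻¹ * eulerDeriv K (xExpHom φ j) (F i)).det := by
  simp_rw [← xVar_mul_xDeriv]
  rw [logJacobian, jacobian, div_eq_mul_inv, ← Finset.prod_inv_distrib,
    mul_comm (∏ i, xVar K φ i), mul_assoc, ← Matrix.det_mul_row, ← Matrix.det_mul_column]
  rfl

-- This removes the choice in the definition: the order of a nonzero `x`-term lies in the support of
-- `f`, so a minimal one must contain the leading monomial of `f`.
omit [IsOrderedAddMonoid Γ] in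
theorem xInitialExponent_eq {f : HahnSeries Γ K} (hf : f ≠ 0) :
    xInitialExponent φ f = xExp φ f.order := by
  classical
  have h : IsXInitialExponent φ f (xInitialExponent φ f) := by
    rw [xInitialExponent, dif_pos hf]
    exact (exists_isXInitialExponent φ f hf).choose_spec
  set k := xInitialExponent φ f
  have h0 : f.coeff f.order ≠ 0 := coeff_order_eq_zero.not.2 hf
  have h1 : (xTerm φ (xExp φ f.order) f).coeff f.order ≠ 0 := by
    simpa [xTerm] using h0
  have h2 : (xTerm φ k f).order ≤ f.order :=
    (h.2 _ fun h' => h1 (by rw [h']; rfl)).trans (order_le_of_coeff_ne_zero h1)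
  have h3 : (if xExp φ (xTerm φ k f).order = k then f.coeff (xTerm φ k f).order else 0) ≠ 0 :=
    coeff_order_eq_zero.not.2 h.1
  obtain ⟨h4, h5⟩ := ite_ne_right_iff.1 h3
  rw [← h4, h2.antisymm (order_le_of_coeff_ne_zero h5)]

/-- This holds even when the Jacobian number vanishes in `K`; nonvanishing matters only for the
order. -/
theorem constTerm_logJacobian (F : Fin n → HahnSeries Γ K) (hF : ∀ i, F i ≠ 0) :
    constTerm φ (logJacobian φ F) = C ((jacobianNumber φ F : ℤ) : K) := by
  choose v hv hFv using fun i => exists_eq_single_mul (hF i)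
  have hv0 : ∀ i, 1 - v i ≠ 0 := fun i h => hF i (by rw [hFv i, h, mul_zero])
  have hLJ : logJacobian φ F = logDet (xExpHom φ)
      (Matrix.of fun i j => xInitialExponent φ (F i) j) v fun i => (1 - v i)⁻¹ := by
    rw [logJacobian_eq_det, logDet]
    congr 1
    ext1 i j
    rw [Matrix.of_apply, Matrix.of_apply, Matrix.of_apply, xInitialExponent_eq φ (hF i)]
    conv_lhs => rw [hFv i]
    exact logDeriv_single_mul _ (coeff_order_eq_zero.not.2 (hF i)) (hv0 i)
  ext γ
  rw [constTerm]
  change (if xExp φ γ = 0 then (logJacobian φ F).coeff γ else 0) = _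
  split_ifs with h
  · rw [hLJ]
    exact coeff_logDet _ _ _ _ hv (fun i => mul_inv_cancel₀ (hv0 i)) fun j => congrFun h j
  · rw [C_apply, coeff_single_of_ne]
    rintro rfl
    exact h (by simp [xExp])

theorem order_logJacobian (F : Fin n → HahnSeries Γ K) (hF : ∀ i, F i ≠ 0)
    (hj : ((jacobianNumber φ F : ℤ) : K) ≠ 0) :
    logJacobian φ F ≠ 0 ∧ (logJacobian φ F).order = 0 := by
  have h0 : (logJacobian φ F).coeff 0 ≠ 0 := by
    have h := congrArg (fun f => f.coeff 0) (constTerm_logJacobian φ F hF)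
    change (if xExp φ 0 = 0 then (logJacobian φ F).coeff 0 else 0) = _ at h
    rw [C_apply, coeff_single_same, if_pos (by simp [xExp])] at h
    rwa [h]
  have hne : logJacobian φ F ≠ 0 := fun h => h0 (by rw [h]; rfl)
  have hmem : logJacobian φ F ∈ nonnegSubring Γ K := by
    rw [logJacobian_eq_det]
    exact det_mem_subring _ _ fun i j => logDeriv_mem_nonnegSubring _ (hF i)
  exact ⟨hne, (order_le_of_coeff_ne_zero h0).antisymm
    (not_lt.1 fun h => coeff_order_eq_zero.not.2 hne (hmem _ h))⟩

end LogJacobian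

end MalcevNeumann

theorem mainTheorem7 {Γ G K : Type*} [AddCommGroup Γ] [LinearOrder Γ] [IsOrderedAddMonoid Γ]
    [AddCommGroup G] [Field K] {n : ℕ} (φ : Γ ≃+ G × (Fin n → ℤ))
    (F : Fin n → HahnSeries Γ K) (hF : ∀ i, F i ≠ 0)
    (hj : ((MalcevNeumann.jacobianNumber φ F : ℤ) : K) ≠ 0) :
    MalcevNeumann.xInitialTerm φ (MalcevNeumann.logJacobian φ F) =
        HahnSeries.C ((MalcevNeumann.jacobianNumber φ F : ℤ) : K) ∧
      MalcevNeumann.constTerm φ (MalcevNeumann.logJacobian φ F) =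
        HahnSeries.C ((MalcevNeumann.jacobianNumber φ F : ℤ) : K) := by
  have hct := MalcevNeumann.constTerm_logJacobian φ F hF
  obtain ⟨hne, hord⟩ := MalcevNeumann.order_logJacobian φ F hF hj
  refine ⟨?_, hct⟩
  -- Order `0` makes the initial exponent `xExp φ 0 = 0`, so both sides are the same `xTerm`.
  rw [MalcevNeumann.xInitialTerm, MalcevNeumann.xInitialExponent_eq φ hne, hord,
    ← hct, MalcevNeumann.constTerm]
  congr 1
  simp [MalcevNeumann.xExp]
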